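/- Let $n\ge 4$, let $a_1>a_2>\dots>a_n>0$, let $0<\delta<\min_{2\le i\le n}\frac{a_{i-1}-a_i}{2}$, and let $E=\{x\in\mathbb R^n:\sum_{i=1}^n x_i^2/a_i^2=1\}$, with radial function $\rho_E(x)=\sup\{s\ge 0: sx\in E\}$. Put $$I_1=\{\theta\in S^{n-1}: a_1-\rho_E(\theta)<\delta,\ \langle\theta,e_1\rangle>0\},\qquad I_2=\{\theta\in S^{n-1}: \rho_E(\theta)-a_n<\delta,\ \langle\theta,e_n\rangle>0\},$$ and for $\varepsilon>0$ and $S\in\{I_1,-I_1\}$ define $\rho_S:S^{n-1}\to\mathbb R$ by $$\rho_S(\theta)=\begin{cases}\rho_E(\theta)-\varepsilon(a_1-\rho_E(\theta)-\delta)^3,&\theta\in S,\\ \rho_E(\theta)+\varepsilon(\rho_E(\theta)-a_n-\delta)^3,&\theta\in I_2,\\ \rho_E(\theta),&\text{otherwise}\end{cases}$$ (the sets $S$ and $I_2$ are disjoint). Let $K=\{r\theta:\theta\in S^{n-1},\,0\le r\le\rho_{I_1}(\theta)\}$ and $L=\{r\theta:\theta\in S^{n-1},\,0\le r\le\rho_{-I_1}(\theta)\}$.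 Then there is $\varepsilon_0>0$ (depending on $n$, the $a_i$ and $\delta$) such that for every $0<\varepsilon<\varepsilon_0$ the sets $K$ and $L$ are convex bodies (compact, convex, with non-empty interior), $K\ne L$, $K\ne -L$, and for every $\xi\in S^{n-1}$ there is a rotation $\phi_\xi\in SO(n-1)$ of the hyperplane $\xi^\perp$ (a linear isometry of $\xi^\perp$ of determinant $1$) with $$\phi_\xi(K\cap\xi^\perp)=L\cap\xi^\perp .$$ Moreover, there is an orthonormal basis $b_1,\dots,b_{n-1}$ of $\xi^\perp$ along principal axes of the section ellipsoid $E\cap\xi^\perp$ (that is, $E\cap\xi^\perp=\{\sum_i y_i b_i:\sum_i y_i^2/c_i^2=1\}$ for some $c_i>0$) such that, if $n$ is even, $\phi_\xi$ is the reflection of $\xi^\perp$ in a line $\mathbb R b_i$, and, if $n$ is odd, $\phi_\xi$ is the reflection of $\xi^\perp$ in a $2$-plane $\operatorname{span}(b_i,b_j)$ with $i\ne j$. Here the reflection in a subspace $H\subset\xi^\perp$ is the isometry which is the identity on $H$ and $-1$ on its orthogonal complement in $\xi^\perp$. In particular, for every $n\ge4$ there exist convex bodies $K,L\subset\mathbb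 R^n$ with $K\neq\pm L$ such that for every $\xi\in S^{n-1}$ some rotation $\phi_\xi\in SO(n-1)$ of $\xi^\perp$ satisfies $\phi_\xi(K\cap\xi^\perp)=L\cap\xi^\perp$. -/

import Mathlib

open scoped Pointwise

noncomputable section

/-- A convex body in `ℝⁿ`: a compact convex set with non-empty interior. -/
structure IsConvexBody {n : ℕ} (K : Set (EuclideanSpace ℝ (Fin n))) : Prop where
  convex : Convex ℝ K
  isCompact : IsCompact K
  interior_nonempty : (interior K).Nonempty

/-- The radial function `ρ_A(x) = sup {s ≥ 0 : s x ∈ A}`. -/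
def radialFunction {n : ℕ} (A : Set (EuclideanSpace ℝ (Fin n)))
    (x : EuclideanSpace ℝ (Fin n)) : ℝ :=
  sSup {s : ℝ | 0 ≤ s ∧ s • x ∈ A}

/-- The set `{r θ : θ ∈ Sⁿ⁻¹, 0 ≤ r ≤ ρ(θ)}`, whose radial function on the sphere is `ρ`
(for `ρ ≥ 0`). -/
def bodyOfRadial {n : ℕ} (ρ : EuclideanSpace ℝ (Fin n) → ℝ) :
    Set (EuclideanSpace ℝ (Fin n)) :=
  {x | ∃ θ ∈ Metric.sphere (0 : EuclideanSpace ℝ (Fin n)) 1,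
    ∃ r : ℝ, 0 ≤ r ∧ r ≤ ρ θ ∧ x = r • θ}

/-- The ellipsoid (surface) with semi-axes `a i` along the standard basis vectors. -/
def ellipsoid {n : ℕ} (a : Fin n → ℝ) : Set (EuclideanSpace ℝ (Fin n)) :=
  {x | ∑ i, x i ^ 2 / a i ^ 2 = 1}

/-- The index of the first coordinate (largest semi-axis). -/
def firstIdx {n : ℕ} (hn : 4 ≤ n) : Fin n := ⟨0, by omega⟩

/-- The index of the last coordinate (smallest semi-axis). -/
def lastIdx {n : ℕ} (hn : 4 ≤ n) : Fin n := ⟨n - 1, by omega⟩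

/-- `I₁ = {θ ∈ Sⁿ⁻¹ : a₁ - ρ_E(θ) < δ, ⟨θ, e₁⟩ > 0}`. -/
def capOne {n : ℕ} (hn : 4 ≤ n) (a : Fin n → ℝ) (δ : ℝ) : Set (EuclideanSpace ℝ (Fin n)) :=
  {θ | θ ∈ Metric.sphere (0 : EuclideanSpace ℝ (Fin n)) 1 ∧
    a (firstIdx hn) - radialFunction (ellipsoid a) θ < δ ∧ 0 < θ (firstIdx hn)}

/-- `I₂ = {θ ∈ Sⁿ⁻¹ : ρ_E(θ) - aₙ < δ, ⟨θ, eₙ⟩ > 0}`. -/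
def capTwo {n : ℕ} (hn : 4 ≤ n) (a : Fin n → ℝ) (δ : ℝ) : Set (EuclideanSpace ℝ (Fin n)) :=
  {θ | θ ∈ Metric.sphere (0 : EuclideanSpace ℝ (Fin n)) 1 ∧
    radialFunction (ellipsoid a) θ - a (lastIdx hn) < δ ∧ 0 < θ (lastIdx hn)}

open Classical in
/-- The radial function `ρ_E`, perturbed by the cubic term of size `ε` near the longest axis on
the set `S`, and near the shortest axis on `I₂`. -/
def perturbedRadial {n : ℕ} (hn : 4 ≤ n) (a : Fin n → ℝ) (δ ε : ℝ)
    (S : Set (EuclideanSpace ℝ (Fin n))) (θ : EuclideanSpace ℝ (Fin n)) : ℝ :=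
  if θ ∈ S then
    radialFunction (ellipsoid a) θ
      - ε * (a (firstIdx hn) - radialFunction (ellipsoid a) θ - δ) ^ 3
  else if θ ∈ capTwo hn a δ then
    radialFunction (ellipsoid a) θ
      + ε * (radialFunction (ellipsoid a) θ - a (lastIdx hn) - δ) ^ 3
  else radialFunction (ellipsoid a) θ

/-- The body `K`: the ellipsoid perturbed on `I₁` and on `I₂`. -/
def bodyK {n : ℕ} (hn : 4 ≤ n) (a : Fin n → ℝ) (δ ε : ℝ) : Set (EuclideanSpace ℝ (Fin n)) :=
  bodyOfRadial (perturbedRadial hn a δ ε (capOne hn a δ))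

/-- The body `L`: the ellipsoid perturbed on `-I₁` and on `I₂`. -/
def bodyL {n : ℕ} (hn : 4 ≤ n) (a : Fin n → ℝ) (δ ε : ℝ) : Set (EuclideanSpace ℝ (Fin n)) :=
  bodyOfRadial (perturbedRadial hn a δ ε (-capOne hn a δ))

/-- The section `A ∩ H`, as a subset of the subspace `H`. -/
def sectionBy {n : ℕ} (A : Set (EuclideanSpace ℝ (Fin n)))
    (H : Submodule ℝ (EuclideanSpace ℝ (Fin n))) : Set H :=
  {x : H | (x : EuclideanSpace ℝ (Fin n)) ∈ A}

/-- The orthonormal basis `b` of `H` spans the principal axes of the section ellipsoid `B ⊆ H`: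
in the coordinates `y₁, …, yₘ` of `b`, `B` is `{∑ yᵢ² / cᵢ² = 1}` for some `cᵢ > 0`. -/
def IsPrincipalBasis {n m : ℕ} {H : Submodule ℝ (EuclideanSpace ℝ (Fin n))} (B : Set H)
    (b : OrthonormalBasis (Fin m) ℝ H) : Prop :=
  ∃ c : Fin m → ℝ, (∀ i, 0 < c i) ∧ B = {y : H | ∑ i, b.repr y i ^ 2 / c i ^ 2 = 1}

end

/-! Write `Q` for the quadratic form of `E` and `u = ‖x‖ / √Q`, the degree-zero extension of `ρ_E`.
Both bodies have radial function `u + ε * capBump`. The bump near the longest axis sits on the side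
`x₁ > 0` for `K` and `x₁ < 0` for `L`; the bump near the shortest axis sits on `xₙ > 0` for both.

Convexity. The cap `u > a₁ - δ` misses the hyperplane `x₁ = 0`, where `u ≤ a₂`, and the cap `u < aₙ
+ δ` misses `xₙ = 0`. Cutting the caps by sign therefore keeps the cubic bumps `C²` away from the
origin. The body is `{√Q ≤ 1 + ε ψ}` with `ψ = capBump / u`, that is, `Q - 2 ε ψ - ε² ψ² - 1 ≤ 0`.
On an annulus containing the boundary the Hessian of `Q` dominates for small `ε`, and a maximum
principle along segments gives convexity (`convex_of_secondDeriv_pos`).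

Sections. Diagonalize `Q` on `ξᗮ` in an orthonormal basis, and let `φ` flip the longest axis, keep
the shortest, and flip or keep each other axis. Then `φ` preserves `u`, so only the signs of `x₁`
and `xₙ` matter. In the section, the cap `u > a₁ - δ` is the negative cone of a quadratic form that
is nonnegative on `x₁ = 0`. This form has at most one negative direction, so its cone has two
nappes, told apart by the longest-axis coordinate, and `x₁` has constant sign on each
(`mul_pos_of_nonneg_on_ker`). Hence `φ` reverses the sign of `x₁` on that cap, and likewise
preserves the sign of `xₙ` on the other: it carries the section of `K` to that of `L`
(`image_section_eq`). Keeping one axis for even `n` and two for odd `n` makes the number of flipped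
axes even, so the determinant is `1`. -/

section MaximumPrinciple

/-! ### Second derivatives along lines and a convexity criterion. -/

open Filter Topology

variable {E : Type*} [NormedAddCommGroup E] [NormedSpace ℝ E]

/-- The second derivative of `f` at `z` in the direction `d`. -/
noncomputable def secondDeriv (f : E → ℝ) (z d : E) : ℝ := iteratedFDeriv ℝ 2 f z ![d, d]

theorem hasDerivAt_add_smul (z d : E) (s : ℝ) : HasDerivAt (fun s : ℝ => z + s • d) d s := by
  simpa using ((hasDerivAt_id s).smul_const d).const_add z

theorem deriv_comp_line_eventuallyEq {f : E → ℝ} {z : E} (hf : ContDiffAt ℝ 2 f z) (d : E) :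
    deriv (fun s : ℝ => f (z + s • d)) =ᶠ[𝓝 0] fun s => fderiv ℝ f (z + s • d) d := by
  have hc : Tendsto (fun s : ℝ => z + s • d) (𝓝 0) (𝓝 z) := by
    simpa using (hasDerivAt_add_smul z d 0).continuousAt.tendsto
  filter_upwards [hc.eventually (hf.eventually (by simp))] with s hs
  exact ((hs.differentiableAt (by simp)).hasFDerivAt.comp_hasDerivAt s
    (hasDerivAt_add_smul z d s)).deriv

theorem deriv_deriv_comp_line {f : E → ℝ} {z : E} (hf : ContDiffAt ℝ 2 f z) (d : E) :
    deriv (deriv fun s : ℝ => f (z + s • d)) 0 = secondDeriv f z d := by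
  have h2 : DifferentiableAt ℝ (fderiv ℝ f) z :=
    (hf.fderiv_right (m := 1) (by norm_num)).differentiableAt (by simp)
  rw [(deriv_comp_line_eventuallyEq hf d).deriv_eq, secondDeriv, iteratedFDeriv_two_apply]
  have h3 : HasFDerivAt (fderiv ℝ f) (fderiv ℝ (fderiv ℝ f) z) (z + (0 : ℝ) • d) := by
    rw [zero_smul, add_zero]
    exact h2.hasFDerivAt
  have h4 : HasDerivAt (fun s : ℝ => fderiv ℝ f (z + s • d)) (fderiv ℝ (fderiv ℝ f) z d) 0 :=
    h3.comp_hasDerivAt (0 : ℝ) (hasDerivAt_add_smul z d 0)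
  have h5 : HasDerivAt (fun s : ℝ => fderiv ℝ f (z + s • d) d)
      (fderiv ℝ (fderiv ℝ f) z d d) 0 := by
    have := (ContinuousLinearMap.apply ℝ ℝ d).hasFDerivAt.comp_hasDerivAt (0 : ℝ) h4
    exact this
  exact h5.deriv

/-- A positive second derivative at a critical point forces a local minimum. If the point were also
a local maximum, the function would be locally constant and its second derivative zero. -/
theorem not_isLocalMax_of_secondDeriv_pos {f : E → ℝ} {z d : E} (hf : ContDiffAt ℝ 2 f z)
    (hpos : 0 < secondDeriv f z d) : ¬ IsLocalMax (fun s : ℝ => f (z + s • d)) 0 := by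
  intro hmax
  have hd2 := deriv_deriv_comp_line hf d
  have hcont : ContinuousAt (fun s : ℝ => f (z + s • d)) 0 := by
    refine ContinuousAt.comp (g := f) ?_ (hasDerivAt_add_smul z d 0).continuousAt
    simpa using hf.continuousAt
  have hmin := isLocalMin_of_deriv_deriv_pos (by rw [hd2]; exact hpos) hmax.deriv_eq_zero hcont
  have hconst : (fun s : ℝ => f (z + s • d)) =ᶠ[𝓝 0] fun _ => f (z + (0 : ℝ) • d) := by
    filter_upwards [hmax, hmin] with s h1 h2 using le_antisymm h1 h2
  have h0 : deriv (deriv fun s : ℝ => f (z + s • d)) 0 = 0 := by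
    rw [hconst.deriv.deriv_eq]
    simp
  linarith

/-- A star body cut out by `f ≤ 0` is convex when `f` is strictly convex, to second order, in the
annulus that contains the boundary of the body. -/
theorem convex_of_secondDeriv_pos {K : Set E} {f : E → ℝ} {m M : ℝ} (hm : 0 < m)
    (hmK : ∀ x, ‖x‖ ≤ m → x ∈ K) (hKM : ∀ x ∈ K, ‖x‖ ≤ M)
    (hK : ∀ x, x ≠ 0 → (x ∈ K ↔ f x ≤ 0)) (hf : ∀ x, x ≠ 0 → ContDiffAt ℝ 2 f x)
    (hpos : ∀ z, m ≤ ‖z‖ → ‖z‖ ≤ M → ∀ d, d ≠ 0 → 0 < secondDeriv f z d) : Convex ℝ K := by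
  rw [convex_iff_add_mem]
  intro x hx y hy p r hp hr hpr
  by_contra hz
  set γ : ℝ → E := fun t => x + t • (y - x) with hγ
  have hγc : Continuous γ := by fun_prop
  have hγr : γ r = p • x + r • y := by
    have : p = 1 - r := by linarith
    simp only [hγ, this]; module
  have hout : ∀ t, γ t ∉ K → m < ‖γ t‖ := fun t ht => by
    by_contra h; exact ht (hmK _ (not_lt.1 h))
  have hne : ∀ t, m ≤ ‖γ t‖ → γ t ≠ 0 := fun t ht => norm_pos_iff.1 (hm.trans_le ht)
  -- Nothing is known about `f` near the origin, so it is maximized only over parameters where the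
  -- segment stays outside the small ball. The point assumed to lie outside `K` shows that `T` is
  -- nonempty.
  set T : Set ℝ := Set.Icc 0 1 ∩ {t | m ≤ ‖γ t‖} with hT
  have hTc : IsCompact T :=
    isCompact_Icc.inter_right (isClosed_le continuous_const hγc.norm)
  have hrT : r ∈ T := ⟨⟨hr, by linarith⟩, (hout r (by rwa [hγr])).le⟩
  have hcont : ContinuousOn (fun t => f (γ t)) T := fun t ht =>
    ((hf _ (hne t ht.2)).continuousAt.comp hγc.continuousAt).continuousWithinAt
  obtain ⟨t, htT, ht⟩ := hTc.exists_isMaxOn ⟨r, hrT⟩ hcont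
  have hnot : ∀ s, m ≤ ‖γ s‖ → (γ s ∉ K ↔ 0 < f (γ s)) := fun s hs => by
    rw [hK _ (hne s hs), not_le]
  have hfr : 0 < f (γ r) := (hnot r hrT.2).1 (by rwa [hγr])
  have hft : 0 < f (γ t) := hfr.trans_le (ht hrT)
  have htK : γ t ∉ K := (hnot t htT.2).2 hft
  have ht0 : t ≠ 0 := by
    rintro rfl; exact htK (by simpa [hγ] using hx)
  have ht1 : t ≠ 1 := by
    rintro rfl; exact htK (by simpa [hγ] using hy)
  have hxy : y - x ≠ 0 := by
    intro h; exact htK (by simpa [hγ, h] using hx)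
  have hM : ‖γ t‖ ≤ M := by
    have hconv := convex_closedBall (0 : E) M
    have h1 : x ∈ Metric.closedBall (0 : E) M := by simpa using hKM x hx
    have h2 : y ∈ Metric.closedBall (0 : E) M := by simpa using hKM y hy
    simpa using hconv.add_smul_sub_mem h1 h2 htT.1
  -- The maximizer lies outside `K`, hence strictly outside the small ball and away from both
  -- endpoints. No constraint is active, so it is a genuine local maximum along the line.
  refine not_isLocalMax_of_secondDeriv_pos (hf _ (hne t htT.2)) (hpos _ htT.2 hM _ hxy) ?_
  have hshift : ∀ s : ℝ, γ t + s • (y - x) = γ (t + s) := fun s => by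
    simp only [hγ]; module
  have htend : Tendsto (fun s : ℝ => t + s) (𝓝 0) (𝓝 t) := by
    have : Continuous fun s : ℝ => t + s := by fun_prop
    simpa using this.tendsto 0
  have hIcc : Set.Icc (0 : ℝ) 1 ∈ 𝓝 t :=
    Icc_mem_nhds (lt_of_le_of_ne htT.1.1 ht0.symm) (lt_of_le_of_ne htT.1.2 ht1)
  have hnorm : {s | m ≤ ‖γ s‖} ∈ 𝓝 t :=
    mem_of_superset ((isOpen_lt continuous_const hγc.norm).mem_nhds (hout t htK))
      fun s (hs : m < ‖γ s‖) => hs.le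
  have hev : ∀ᶠ s in 𝓝 t, f (γ s) ≤ f (γ t) := by
    filter_upwards [hIcc, hnorm] with s h1 h2 using ht ⟨h1, h2⟩
  filter_upwards [htend.eventually hev] with s hs
  simpa [hshift] using hs

theorem secondDeriv_bounded [FiniteDimensional ℝ E] {P : E → ℝ}
    (hP : ∀ x, x ≠ 0 → ContDiffAt ℝ 2 P x) {m : ℝ} (hm : 0 < m) (M : ℝ) :
    ∃ C, 0 ≤ C ∧ ∀ z, m ≤ ‖z‖ → ‖z‖ ≤ M → ∀ d, |secondDeriv P z d| ≤ C * ‖d‖ ^ 2 := by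
  have hA : IsCompact (Metric.closedBall (0 : E) M ∩ {z | m ≤ ‖z‖}) :=
    (isCompact_closedBall _ _).inter_right (isClosed_le continuous_const continuous_norm)
  have hc : ContinuousOn (iteratedFDeriv ℝ 2 P)
      (Metric.closedBall (0 : E) M ∩ {z | m ≤ ‖z‖}) := by
    intro z hz
    have hz0 : z ≠ 0 := norm_pos_iff.1 (hm.trans_le hz.2)
    exact ((hP z hz0).iteratedFDeriv_right (i := 2) (m := 0) (by norm_num)).continuousAt.continuousWithinAt
  obtain ⟨C, hC⟩ := hA.exists_bound_of_continuousOn hc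
  refine ⟨max C 0, le_max_right _ _, fun z h1 h2 d => ?_⟩
  have := (iteratedFDeriv ℝ 2 P z).le_opNorm ![d, d]
  rw [Fin.prod_univ_two] at this
  calc |secondDeriv P z d| ≤ ‖iteratedFDeriv ℝ 2 P z‖ * (‖d‖ * ‖d‖) := this
    _ ≤ max C 0 * (‖d‖ * ‖d‖) := by
      gcongr
      exact (hC z ⟨by simpa using h2, h1⟩).trans (le_max_left _ _)
    _ = _ := by ring

theorem secondDeriv_sub_sub_mul {q ψ χ : E → ℝ} {z : E} (hq : ContDiffAt ℝ 2 q z)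
    (hψ : ContDiffAt ℝ 2 ψ z) (hχ : ContDiffAt ℝ 2 χ z) (b c e : ℝ) (d : E) :
    secondDeriv (fun x => q x - b * ψ x - c * χ x - e) z d
      = secondDeriv q z d - b * secondDeriv ψ z d - c * secondDeriv χ z d := by
  have hline : ContDiffAt ℝ 2 (fun s : ℝ => z + s • d) 0 := by fun_prop
  have key : ∀ {g : E → ℝ}, ContDiffAt ℝ 2 g z →
      ContDiffAt ℝ 2 (fun s : ℝ => g (z + s • d)) 0 := fun {g} hg =>
    ContDiffAt.comp (g := g) (0 : ℝ) (by simpa using hg) hline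
  have hdd : ∀ {g : E → ℝ}, ContDiffAt ℝ 2 g z →
      secondDeriv g z d = iteratedDeriv 2 (fun s : ℝ => g (z + s • d)) 0 := fun {g} hg => by
    rw [← deriv_deriv_comp_line hg, iteratedDeriv_succ, iteratedDeriv_one]
  have h1 := hψ.const_smul b
  have h2 := hχ.const_smul c
  rw [hdd hq, hdd hψ, hdd hχ, hdd (by fun_prop)]
  have e1 : ContDiffAt ℝ (2 : ℕ) (fun s : ℝ => q (z + s • d)) 0 := key hq
  have e2 : ContDiffAt ℝ (2 : ℕ) (fun s : ℝ => b * ψ (z + s • d)) 0 := contDiffAt_const.mul (key hψ)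
  have e3 : ContDiffAt ℝ (2 : ℕ) (fun s : ℝ => c * χ (z + s • d)) 0 := contDiffAt_const.mul (key hχ)
  rw [iteratedDeriv_fun_sub ((e1.sub e2).sub e3) contDiffAt_const,
    iteratedDeriv_fun_sub (e1.sub e2) e3, iteratedDeriv_fun_sub e1 e2,
    iteratedDeriv_const_mul_field, iteratedDeriv_const_mul_field]
  simp [iteratedDeriv_const]

end MaximumPrinciple

/-! ### Star bodies given by a radial function. -/

section RadialBody

open Filter Topology

variable {n : ℕ}

theorem mem_bodyOfRadial_iff {ρ : EuclideanSpace ℝ (Fin n) → ℝ} {x : EuclideanSpace ℝ (Fin n)}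
    (hx : x ≠ 0) : x ∈ bodyOfRadial ρ ↔ ‖x‖ ≤ ρ (‖x‖⁻¹ • x) := by
  have hx' : 0 < ‖x‖ := norm_pos_iff.2 hx
  constructor
  · rintro ⟨θ, hθ, r, hr, hrρ, rfl⟩
    have hθ1 : ‖θ‖ = 1 := by simpa using hθ
    have hr0 : r ≠ 0 := by rintro rfl; simp at hx
    have hn : ‖r • θ‖ = r := by rw [norm_smul, hθ1, Real.norm_of_nonneg hr, mul_one]
    rw [hn, smul_smul, inv_mul_cancel₀ hr0, one_smul]
    exact hrρ
  · intro h
    refine ⟨‖x‖⁻¹ • x, ?_, ‖x‖, hx'.le, h, ?_⟩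
    · simp [norm_smul, hx'.ne']
    · rw [smul_smul, mul_inv_cancel₀ hx'.ne', one_smul]

theorem mem_bodyOfRadial_of_norm_le [Nontrivial (EuclideanSpace ℝ (Fin n))]
    {ρ : EuclideanSpace ℝ (Fin n) → ℝ} {m : ℝ} (hm : 0 ≤ m)
    (hρ : ∀ θ ∈ Metric.sphere (0 : EuclideanSpace ℝ (Fin n)) 1, m ≤ ρ θ)
    {x : EuclideanSpace ℝ (Fin n)} (hx : ‖x‖ ≤ m) : x ∈ bodyOfRadial ρ := by
  by_cases h0 : x = 0
  · obtain ⟨θ, hθ⟩ := NormedSpace.sphere_nonempty (E := EuclideanSpace ℝ (Fin n)) (x := 0)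
      |>.2 (zero_le_one (α := ℝ))
    exact ⟨θ, hθ, 0, le_rfl, hm.trans (hρ θ hθ), by simp [h0]⟩
  · rw [mem_bodyOfRadial_iff h0]
    refine hx.trans (hρ _ ?_)
    simp [norm_smul, h0]

theorem isCompact_bodyOfRadial {ρ : EuclideanSpace ℝ (Fin n) → ℝ}
    (hc : ContinuousOn ρ (Metric.sphere 0 1))
    (hρ : ∀ θ ∈ Metric.sphere (0 : EuclideanSpace ℝ (Fin n)) 1, 0 < ρ θ) :
    IsCompact (bodyOfRadial ρ) := by
  have himg : bodyOfRadial ρ = (fun p : EuclideanSpace ℝ (Fin n) × ℝ => (p.2 * ρ p.1) • p.1) ''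
      (Metric.sphere 0 1 ×ˢ Set.Icc 0 1) := by
    ext x
    constructor
    · rintro ⟨θ, hθ, r, hr, hrρ, rfl⟩
      refine ⟨(θ, r / ρ θ), ⟨hθ, div_nonneg hr (hρ θ hθ).le, ?_⟩, ?_⟩
      · exact (div_le_one (hρ θ hθ)).2 hrρ
      · simp only []
        rw [div_mul_cancel₀ _ (hρ θ hθ).ne']
    · rintro ⟨⟨θ, t⟩, ⟨hθ, ht0, ht1⟩, rfl⟩
      exact ⟨θ, hθ, t * ρ θ, mul_nonneg ht0 (hρ θ hθ).le,
        mul_le_of_le_one_left (hρ θ hθ).le ht1, rfl⟩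
  rw [himg]
  refine ((isCompact_sphere _ _).prod isCompact_Icc).image_of_continuousOn ?_
  have h1 : ContinuousOn (fun p : EuclideanSpace ℝ (Fin n) × ℝ => ρ p.1)
      (Metric.sphere 0 1 ×ˢ Set.Icc 0 1) :=
    hc.comp continuousOn_fst fun p hp => hp.1
  exact (continuousOn_snd.mul h1).smul continuousOn_fst

end RadialBody

/-! ### The truncated cube and its one-sided cut-off. -/

section CubicBump

open Filter Topology

theorem hasDerivAt_max_zero_pow (k : ℕ) (t : ℝ) :
    HasDerivAt (fun t : ℝ => max t 0 ^ (k + 2)) ((k + 2) * max t 0 ^ (k + 1)) t := by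
  have hR : HasDerivWithinAt (fun t : ℝ => max t 0 ^ (k + 2)) ((k + 2) * max t 0 ^ (k + 1))
      (Set.Ici 0) t ∨ t < 0 := by
    by_cases ht : 0 ≤ t
    · left
      have h := (hasDerivAt_pow (k + 2) t).hasDerivWithinAt (s := Set.Ici (0 : ℝ))
      rw [max_eq_left ht]
      refine (h.congr (fun s (hs : 0 ≤ s) => by rw [max_eq_left hs]) (by rw [max_eq_left ht])).congr_deriv ?_
      push_cast; simp
    · exact Or.inr (not_le.1 ht)
  have hL : HasDerivWithinAt (fun t : ℝ => max t 0 ^ (k + 2)) ((k + 2) * max t 0 ^ (k + 1))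
      (Set.Iic 0) t ∨ 0 < t := by
    by_cases ht : t ≤ 0
    · left
      rw [max_eq_right ht, zero_pow (by simp), mul_zero]
      exact (hasDerivWithinAt_const t _ (0 : ℝ)).congr
        (fun s (hs : s ≤ 0) => by simp [max_eq_right hs]) (by simp [max_eq_right ht])
    · exact Or.inr (not_le.1 ht)
  rcases hR with hR | hR
  · rcases hL with hL | hL
    · have := hL.union hR
      rwa [Set.Iic_union_Ici, hasDerivWithinAt_univ] at this
    · exact hR.hasDerivAt (Ici_mem_nhds hL)
  · rcases hL with hL | hL
    · exact hL.hasDerivAt (Iic_mem_nhds hR)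
    · linarith

theorem contDiff_max_zero_cube : ContDiff ℝ 2 fun t : ℝ => max t 0 ^ 3 := by
  have h1 : ∀ k : ℕ, deriv (fun t : ℝ => max t 0 ^ (k + 2))
      = fun t => ((k : ℝ) + 2) * max t 0 ^ (k + 1) := fun k =>
    funext fun t => (hasDerivAt_max_zero_pow k t).deriv
  have hd : ∀ k : ℕ, Differentiable ℝ fun t : ℝ => max t 0 ^ (k + 2) := fun k t =>
    (hasDerivAt_max_zero_pow k t).differentiableAt
  have hsq : ContDiff ℝ 1 fun t : ℝ => max t 0 ^ 2 := by
    rw [contDiff_one_iff_deriv]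
    refine ⟨hd 0, ?_⟩
    rw [h1 0]
    fun_prop
  rw [show (2 : WithTop ℕ∞) = 1 + 1 by norm_num, contDiff_succ_iff_deriv]
  refine ⟨hd 1, by simp, ?_⟩
  rw [h1 1]
  exact contDiff_const.mul hsq

/-- The switch at `ℓ = 0` is harmless: there `g < 0`, so the truncated cube already vanishes in a
neighbourhood. -/
theorem contDiffAt_ite_max_zero_cube {E : Type*} [NormedAddCommGroup E] [NormedSpace ℝ E]
    {ℓ g : E → ℝ} {x : E} (hℓ : Continuous ℓ) (hg : ContDiffAt ℝ 2 g x)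
    (h : ℓ x = 0 → g x < 0) :
    ContDiffAt ℝ 2 (fun y => if 0 < ℓ y then max (g y) 0 ^ 3 else 0) x := by
  have hmain : ContDiffAt ℝ 2 (fun y => max (g y) 0 ^ 3) x :=
    contDiff_max_zero_cube.contDiffAt.comp x hg
  rcases lt_trichotomy (ℓ x) 0 with hneg | hzero | hpos
  · refine (contDiffAt_const (c := (0 : ℝ))).congr_of_eventuallyEq ?_
    filter_upwards [(isOpen_lt hℓ continuous_const).mem_nhds hneg] with y hy
    exact if_neg (not_lt.2 (le_of_lt hy))
  · refine (contDiffAt_const (c := (0 : ℝ))).congr_of_eventuallyEq ?_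
    filter_upwards [hg.continuousAt.eventually (gt_mem_nhds (h hzero))] with y hy
    simp [max_eq_right hy.le]
  · refine hmain.congr_of_eventuallyEq ?_
    filter_upwards [(isOpen_lt continuous_const hℓ).mem_nhds hpos] with y hy
    exact if_pos hy

end CubicBump

/-! ### The quadratic form and radial function of the ellipsoid. -/

section Ellipsoid

variable {n : ℕ}

/-- The quadratic form whose unit level set is the ellipsoid. -/
noncomputable def quadForm (a : Fin n → ℝ) (x : EuclideanSpace ℝ (Fin n)) : ℝ :=
  ∑ i, x i ^ 2 / a i ^ 2

/-- The homogeneous extension of degree zero of the radial function of the ellipsoid. -/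
noncomputable def normRatio (a : Fin n → ℝ) (x : EuclideanSpace ℝ (Fin n)) : ℝ :=
  ‖x‖ / √(quadForm a x)

theorem quadForm_smul (a : Fin n → ℝ) (t : ℝ) (x : EuclideanSpace ℝ (Fin n)) :
    quadForm a (t • x) = t ^ 2 * quadForm a x := by
  simp only [quadForm, Finset.mul_sum]
  refine Finset.sum_congr rfl fun i _ => ?_
  simp; ring

theorem contDiff_quadForm (a : Fin n → ℝ) : ContDiff ℝ 2 (quadForm a) := by
  unfold quadForm
  refine ContDiff.sum fun i _ => ?_
  have : ContDiff ℝ 2 fun x : EuclideanSpace ℝ (Fin n) => x i := contDiff_piLp_apply 2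
  exact (this.pow 2).div_const _

theorem quadForm_neg (a : Fin n → ℝ) (x : EuclideanSpace ℝ (Fin n)) :
    quadForm a (-x) = quadForm a x := by simp [quadForm]

theorem normRatio_neg (a : Fin n → ℝ) (x : EuclideanSpace ℝ (Fin n)) :
    normRatio a (-x) = normRatio a x := by simp [normRatio, quadForm_neg]

theorem secondDeriv_quadForm (a : Fin n → ℝ) (z d : EuclideanSpace ℝ (Fin n)) :
    secondDeriv (quadForm a) z d = 2 * quadForm a d := by
  rw [← deriv_deriv_comp_line (contDiff_quadForm a).contDiffAt]
  set B := ∑ i, z i * d i / a i ^ 2 with hB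
  have h0 : (fun s : ℝ => quadForm a (z + s • d))
      = fun s => quadForm a z + 2 * s * B + s ^ 2 * quadForm a d := by
    funext s
    simp only [quadForm, hB, Finset.mul_sum, ← Finset.sum_add_distrib]
    refine Finset.sum_congr rfl fun i _ => ?_
    simp; ring
  have h1 : deriv (fun s : ℝ => quadForm a (z + s • d))
      = fun s => 2 * B + 2 * s * quadForm a d := by
    funext s
    rw [h0]
    have := (((((hasDerivAt_id s).const_mul 2).mul_const B).const_add (quadForm a z)).add
      ((hasDerivAt_pow 2 s).mul_const (quadForm a d)))
    refine (this.congr_deriv ?_).deriv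
    simp
  rw [h1]
  have := ((((hasDerivAt_id (0 : ℝ)).const_mul 2).mul_const (quadForm a d)).const_add (2 * B))
  refine (this.congr_deriv ?_).deriv
  simp

theorem quadForm_pos {a : Fin n → ℝ} (ha : ∀ i, 0 < a i) {x : EuclideanSpace ℝ (Fin n)}
    (hx : x ≠ 0) : 0 < quadForm a x := by
  obtain ⟨i, hi⟩ : ∃ i, x i ≠ 0 := by
    by_contra! h; exact hx (by ext i; simpa using h i)
  refine Finset.sum_pos' (fun j _ => by positivity) ⟨i, Finset.mem_univ _, ?_⟩
  have := ha i
  positivity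

/-- Coordinates that vanish impose no condition on their semi-axes, which gives sharper bounds on
coordinate hyperplanes. -/
theorem norm_sq_div_le_quadForm {a : Fin n → ℝ} (ha : ∀ i, 0 < a i) {c : ℝ}
    {x : EuclideanSpace ℝ (Fin n)} (hx : ∀ i, x i = 0 ∨ a i ≤ c) :
    ‖x‖ ^ 2 / c ^ 2 ≤ quadForm a x := by
  rw [EuclideanSpace.real_norm_sq_eq, Finset.sum_div, quadForm]
  refine Finset.sum_le_sum fun i _ => ?_
  have := ha i
  rcases hx i with h | h
  · simp [h]
  · gcongr

theorem quadForm_le_norm_sq_div {a : Fin n → ℝ} {c : ℝ} (hc : 0 < c)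
    {x : EuclideanSpace ℝ (Fin n)} (hx : ∀ i, x i = 0 ∨ c ≤ a i) :
    quadForm a x ≤ ‖x‖ ^ 2 / c ^ 2 := by
  rw [EuclideanSpace.real_norm_sq_eq, Finset.sum_div, quadForm]
  refine Finset.sum_le_sum fun i _ => ?_
  rcases hx i with h | h
  · simp [h]
  · gcongr

/-- Squaring turns a cap of the sphere into the negative cone of a quadratic form, to which linear
algebra applies. -/
theorem lt_normRatio_iff {a : Fin n → ℝ} (ha : ∀ i, 0 < a i) {c : ℝ} (hc : 0 < c)
    {x : EuclideanSpace ℝ (Fin n)} (hx : x ≠ 0) :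
    c < normRatio a x ↔ quadForm a x < ‖x‖ ^ 2 / c ^ 2 := by
  have hq := quadForm_pos ha hx
  rw [normRatio, lt_div_iff₀ (Real.sqrt_pos.2 hq), lt_div_iff₀ (by positivity),
    ← sq_lt_sq₀ (by positivity) (by positivity), mul_pow, Real.sq_sqrt hq.le, mul_comm]

theorem normRatio_lt_iff {a : Fin n → ℝ} (ha : ∀ i, 0 < a i) {c : ℝ} (hc : 0 < c)
    {x : EuclideanSpace ℝ (Fin n)} (hx : x ≠ 0) :
    normRatio a x < c ↔ ‖x‖ ^ 2 / c ^ 2 < quadForm a x := by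
  have hq := quadForm_pos ha hx
  rw [normRatio, div_lt_iff₀ (Real.sqrt_pos.2 hq), div_lt_iff₀ (by positivity),
    ← sq_lt_sq₀ (by positivity) (by positivity), mul_pow, Real.sq_sqrt hq.le, mul_comm]

theorem normRatio_le {a : Fin n → ℝ} (ha : ∀ i, 0 < a i) {c : ℝ} (hc : 0 < c)
    {x : EuclideanSpace ℝ (Fin n)} (hx : x ≠ 0) (h : ∀ i, x i = 0 ∨ a i ≤ c) :
    normRatio a x ≤ c := by
  rw [← not_lt, lt_normRatio_iff ha hc hx, not_lt]
  exact norm_sq_div_le_quadForm ha h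

theorem le_normRatio {a : Fin n → ℝ} (ha : ∀ i, 0 < a i) {c : ℝ} (hc : 0 < c)
    {x : EuclideanSpace ℝ (Fin n)} (hx : x ≠ 0) (h : ∀ i, x i = 0 ∨ c ≤ a i) :
    c ≤ normRatio a x := by
  rw [← not_lt, normRatio_lt_iff ha hc hx, not_lt]
  exact quadForm_le_norm_sq_div hc h

theorem normRatio_smul (a : Fin n → ℝ) {t : ℝ} (ht : 0 < t) (x : EuclideanSpace ℝ (Fin n)) :
    normRatio a (t • x) = normRatio a x := by
  rw [normRatio, normRatio, quadForm_smul, Real.sqrt_mul (sq_nonneg t), Real.sqrt_sq ht.le,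
    norm_smul, Real.norm_of_nonneg ht.le, mul_div_mul_left _ _ ht.ne']

theorem contDiffAt_normRatio {a : Fin n → ℝ} (ha : ∀ i, 0 < a i)
    {x : EuclideanSpace ℝ (Fin n)} (hx : x ≠ 0) : ContDiffAt ℝ 2 (normRatio a) x := by
  have hq := quadForm_pos ha hx
  exact (contDiffAt_norm ℝ hx).div ((contDiff_quadForm a).contDiffAt.sqrt hq.ne')
    (Real.sqrt_pos.2 hq).ne'

theorem radialFunction_ellipsoid {a : Fin n → ℝ} (ha : ∀ i, 0 < a i)
    {θ : EuclideanSpace ℝ (Fin n)} (hθ : θ ∈ Metric.sphere 0 1) :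
    radialFunction (ellipsoid a) θ = normRatio a θ := by
  have hθ1 : ‖θ‖ = 1 := by simpa using hθ
  have hθ0 : θ ≠ 0 := by rintro rfl; simp at hθ1
  have hq := quadForm_pos ha hθ0
  have hset : {s : ℝ | 0 ≤ s ∧ s • θ ∈ ellipsoid a} = {normRatio a θ} := by
    ext s
    have hmem : s • θ ∈ ellipsoid a ↔ s ^ 2 * quadForm a θ = 1 := by
      rw [← quadForm_smul]; rfl
    rw [Set.mem_ofPred_eq, hmem, Set.mem_singleton_iff, normRatio, hθ1,
      eq_div_iff (Real.sqrt_pos.2 hq).ne']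
    constructor
    · rintro ⟨h0, h1⟩
      rw [← sq_eq_sq₀ (by positivity) zero_le_one, mul_pow, Real.sq_sqrt hq.le, h1, one_pow]
    · intro h
      refine ⟨?_, ?_⟩
      · by_contra hs
        have := mul_neg_of_neg_of_pos (not_le.1 hs) (Real.sqrt_pos.2 hq)
        linarith
      · rw [← Real.sq_sqrt hq.le, ← mul_pow, h, one_pow]
  rw [radialFunction, hset, csSup_singleton]

end Ellipsoid

/-! ### The bumps, their smoothness, and convexity for small `ε`. -/

section PerturbedBody

variable {n : ℕ}

theorem lt_firstIdx_sub (hn : 4 ≤ n) {a : Fin n → ℝ} (ha : StrictAnti a) {δ : ℝ} (hδ : 0 < δ)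
    (hδa : ∀ i j : Fin n, (i : ℕ) + 1 = (j : ℕ) → δ < (a i - a j) / 2) {i : Fin n}
    (hi : i ≠ firstIdx hn) : a i < a (firstIdx hn) - δ := by
  have h1 := hδa (firstIdx hn) ⟨1, by omega⟩ rfl
  have hi0 : (i : ℕ) ≠ 0 := fun h => hi (Fin.ext h)
  have h2 : a i ≤ a ⟨1, by omega⟩ := ha.antitone (Fin.mk_le_of_le_val (by omega))
  linarith

theorem lastIdx_add_lt (hn : 4 ≤ n) {a : Fin n → ℝ} (ha : StrictAnti a) {δ : ℝ} (hδ : 0 < δ)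
    (hδa : ∀ i j : Fin n, (i : ℕ) + 1 = (j : ℕ) → δ < (a i - a j) / 2) {i : Fin n}
    (hi : i ≠ lastIdx hn) : a (lastIdx hn) + δ < a i := by
  have h1 := hδa ⟨n - 2, by omega⟩ (lastIdx hn) (by simp [lastIdx]; omega)
  have hi0 : (i : ℕ) ≠ n - 1 := fun h => hi (Fin.ext h)
  have h2 : a ⟨n - 2, by omega⟩ ≤ a i := ha.antitone (Fin.le_def.2 (by simp; omega))
  linarith

theorem firstIdx_ne_lastIdx (hn : 4 ≤ n) : firstIdx hn ≠ lastIdx hn := by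
  intro h
  have := congrArg Fin.val h
  simp [firstIdx, lastIdx] at this
  omega

theorem lastIdx_add_lt_firstIdx_sub (hn : 4 ≤ n) {a : Fin n → ℝ} (ha : StrictAnti a) {δ : ℝ}
    (hδ : 0 < δ) (hδa : ∀ i j : Fin n, (i : ℕ) + 1 = (j : ℕ) → δ < (a i - a j) / 2) :
    a (lastIdx hn) + δ < a (firstIdx hn) - δ := by
  have h1 := lt_firstIdx_sub hn ha hδ hδa (i := ⟨1, by omega⟩) (by simp [firstIdx])
  have h2 := lastIdx_add_lt hn ha hδ hδa (i := ⟨1, by omega⟩)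
    (by simp [lastIdx]; omega)
  linarith

/-- The perturbation of the radial function, for `ε = 1`: the cubic bump near the longest axis
lives on the side of the coordinate hyperplane selected by the sign of `s`. -/
noncomputable def capBump (hn : 4 ≤ n) (a : Fin n → ℝ) (δ s : ℝ)
    (x : EuclideanSpace ℝ (Fin n)) : ℝ :=
  (if 0 < s * x (firstIdx hn) then max (normRatio a x - (a (firstIdx hn) - δ)) 0 ^ 3 else 0)
    - (if 0 < x (lastIdx hn) then max (a (lastIdx hn) + δ - normRatio a x) 0 ^ 3 else 0)

theorem capBump_smul (hn : 4 ≤ n) (a : Fin n → ℝ) (δ s : ℝ) {t : ℝ} (ht : 0 < t)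
    (x : EuclideanSpace ℝ (Fin n)) : capBump hn a δ s (t • x) = capBump hn a δ s x := by
  have h1 : 0 < s * (t • x) (firstIdx hn) ↔ 0 < s * x (firstIdx hn) := by
    rw [PiLp.smul_apply, smul_eq_mul, mul_left_comm, mul_pos_iff_of_pos_left ht]
  have h2 : 0 < (t • x) (lastIdx hn) ↔ 0 < x (lastIdx hn) := by
    rw [PiLp.smul_apply, smul_eq_mul, mul_pos_iff_of_pos_left ht]
  simp only [capBump, h1, h2, normRatio_smul a ht]

variable (hn : 4 ≤ n) {a : Fin n → ℝ} (ha : StrictAnti a) (hpos : ∀ i, 0 < a i) {δ : ℝ}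
  (hδ : 0 < δ) (hδa : ∀ i j : Fin n, (i : ℕ) + 1 = (j : ℕ) → δ < (a i - a j) / 2)

include ha hpos in
theorem normRatio_le_firstIdx {x : EuclideanSpace ℝ (Fin n)} (hx : x ≠ 0) :
    normRatio a x ≤ a (firstIdx hn) :=
  normRatio_le hpos (hpos _) hx fun i =>
    Or.inr (ha.antitone (Fin.le_def.2 (by simp [firstIdx])))

include ha hpos in
theorem lastIdx_le_normRatio {x : EuclideanSpace ℝ (Fin n)} (hx : x ≠ 0) :
    a (lastIdx hn) ≤ normRatio a x :=
  le_normRatio hpos (hpos _) hx fun i =>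
    Or.inr (ha.antitone (Fin.le_def.2 (by have := i.2; simp [lastIdx]; omega)))

include ha hpos hδ in
theorem abs_capBump_le {x : EuclideanSpace ℝ (Fin n)} (hx : x ≠ 0) (s : ℝ) :
    |capBump hn a δ s x| ≤ δ ^ 3 := by
  have h1 := normRatio_le_firstIdx hn ha hpos hx
  have h2 := lastIdx_le_normRatio hn ha hpos hx
  have hb : ∀ (p : Prop) [Decidable p] (t : ℝ), t ≤ δ →
      0 ≤ (if p then max t 0 ^ 3 else 0) ∧ (if p then max t 0 ^ 3 else 0) ≤ δ ^ 3 := by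
    intro p _ t ht
    split_ifs
    · exact ⟨by positivity, by gcongr; exact max_le ht hδ.le⟩
    · exact ⟨le_rfl, by positivity⟩
  have h3 := hb (0 < s * x (firstIdx hn)) (normRatio a x - (a (firstIdx hn) - δ)) (by linarith)
  have h4 := hb (0 < x (lastIdx hn)) (a (lastIdx hn) + δ - normRatio a x) (by linarith)
  rw [capBump, abs_le]
  constructor <;> linarith [h3.1, h3.2, h4.1, h4.2]

include ha hpos hδ hδa in
-- Without the first coordinate the longest available semi-axis is the second one. This separation
-- of the cap from the hyperplane serves both smoothness and the sign argument in sections.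
theorem normRatio_lt_of_firstIdx_eq_zero {x : EuclideanSpace ℝ (Fin n)} (hx : x ≠ 0)
    (h : x (firstIdx hn) = 0) : normRatio a x < a (firstIdx hn) - δ := by
  have h1 : ∀ i, i ≠ firstIdx hn → a i ≤ a ⟨1, by omega⟩ := fun i hi =>
    ha.antitone (Fin.mk_le_of_le_val (Nat.one_le_iff_ne_zero.2 fun h => hi (Fin.ext h)))
  refine (normRatio_le hpos (hpos ⟨1, by omega⟩) hx fun i => ?_).trans_lt
    (lt_firstIdx_sub hn ha hδ hδa (by simp [firstIdx]))
  by_cases hi : i = firstIdx hn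
  · exact Or.inl (hi ▸ h)
  · exact Or.inr (h1 i hi)

include ha hpos hδ hδa in
theorem lt_normRatio_of_lastIdx_eq_zero {x : EuclideanSpace ℝ (Fin n)} (hx : x ≠ 0)
    (h : x (lastIdx hn) = 0) : a (lastIdx hn) + δ < normRatio a x := by
  have h1 : ∀ i, i ≠ lastIdx hn → a ⟨n - 2, by omega⟩ ≤ a i := fun i hi =>
    ha.antitone (Fin.le_def.2 (by
      have : (i : ℕ) ≠ n - 1 := fun h => hi (Fin.ext h)
      have := i.2
      simp; omega))
  refine (lastIdx_add_lt hn ha hδ hδa (i := ⟨n - 2, by omega⟩)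
    (by simp [lastIdx]; omega)).trans_le
    (le_normRatio hpos (hpos ⟨n - 2, by omega⟩) hx fun i => ?_)
  by_cases hi : i = lastIdx hn
  · exact Or.inl (hi ▸ h)
  · exact Or.inr (h1 i hi)

include ha hpos hδ hδa in
theorem contDiffAt_capBump {s : ℝ} (hs : s ≠ 0) {x : EuclideanSpace ℝ (Fin n)} (hx : x ≠ 0) :
    ContDiffAt ℝ 2 (capBump hn a δ s) x := by
  have hu := contDiffAt_normRatio hpos hx
  refine (contDiffAt_ite_max_zero_cube (by fun_prop) (hu.sub contDiffAt_const) fun h => ?_).sub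
    (contDiffAt_ite_max_zero_cube (by fun_prop) (contDiffAt_const.sub hu) fun h => ?_)
  · have := normRatio_lt_of_firstIdx_eq_zero hn ha hpos hδ hδa hx
      ((mul_eq_zero.1 h).resolve_left hs)
    linarith
  · have := lt_normRatio_of_lastIdx_eq_zero hn ha hpos hδ hδa hx h
    linarith

include ha hpos hδ hδa in
-- The two caps are disjoint because `aₙ + δ < a₁ - δ`, so the nested cases collapse to a sum of two
-- independent bumps.
theorem perturbedRadial_eq {s : ℝ} {S : Set (EuclideanSpace ℝ (Fin n))}
    (hS : ∀ θ, θ ∈ S ↔ θ ∈ Metric.sphere 0 1 ∧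
      a (firstIdx hn) - radialFunction (ellipsoid a) θ < δ ∧ 0 < s * θ (firstIdx hn))
    (ε : ℝ) {θ : EuclideanSpace ℝ (Fin n)} (hθ : θ ∈ Metric.sphere 0 1) :
    perturbedRadial hn a δ ε S θ = normRatio a θ + ε * capBump hn a δ s θ := by
  have hαβ := lastIdx_add_lt_firstIdx_sub hn ha hδ hδa
  have h1 : θ ∈ S ↔ a (firstIdx hn) - normRatio a θ < δ ∧ 0 < s * θ (firstIdx hn) := by
    rw [hS, radialFunction_ellipsoid hpos hθ]; exact and_iff_right hθ
  have h2 : θ ∈ capTwo hn a δ ↔ normRatio a θ - a (lastIdx hn) < δ ∧ 0 < θ (lastIdx hn) := by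
    rw [← radialFunction_ellipsoid hpos hθ]; exact and_iff_right hθ
  simp only [perturbedRadial, h1, h2, radialFunction_ellipsoid hpos hθ, capBump]
  by_cases hu : a (firstIdx hn) - normRatio a θ < δ
  · have hv : a (lastIdx hn) + δ - normRatio a θ ≤ 0 := by linarith
    have hw : 0 ≤ normRatio a θ - (a (firstIdx hn) - δ) := by linarith
    have hv' : ¬ normRatio a θ - a (lastIdx hn) < δ := by linarith
    simp only [hu, hv', max_eq_right hv, max_eq_left hw, true_and, false_and, if_false]
    split_ifs <;> ring
  · have hw : normRatio a θ - (a (firstIdx hn) - δ) ≤ 0 := by linarith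
    simp only [hu, max_eq_right hw, false_and, if_false]
    by_cases hv : normRatio a θ - a (lastIdx hn) < δ
    · have hv' : 0 ≤ a (lastIdx hn) + δ - normRatio a θ := by linarith
      simp only [hv, max_eq_left hv', true_and]
      split_ifs <;> ring
    · have hv' : a (lastIdx hn) + δ - normRatio a θ ≤ 0 := by linarith
      simp only [hv, max_eq_right hv', false_and, if_false]
      split_ifs <;> ring

/-- The body whose radial function is that of the ellipsoid, perturbed by `ε * capBump`. -/
def IsBumpedEllipsoid (hn : 4 ≤ n) (a : Fin n → ℝ) (δ s ε : ℝ)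
    (K : Set (EuclideanSpace ℝ (Fin n))) : Prop :=
  ∃ ρ, K = bodyOfRadial ρ ∧
    ∀ θ ∈ Metric.sphere (0 : EuclideanSpace ℝ (Fin n)) 1,
      ρ θ = normRatio a θ + ε * capBump hn a δ s θ

include ha hpos hδ hδa in
theorem isBumpedEllipsoid_bodyK (ε : ℝ) : IsBumpedEllipsoid hn a δ 1 ε (bodyK hn a δ ε) :=
  ⟨_, rfl, fun θ hθ => perturbedRadial_eq hn ha hpos hδ hδa (by simp [capOne]) ε hθ⟩

include ha hpos hδ hδa in
theorem isBumpedEllipsoid_bodyL (ε : ℝ) : IsBumpedEllipsoid hn a δ (-1) ε (bodyL hn a δ ε) := by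
  refine ⟨_, rfl, fun θ hθ => perturbedRadial_eq hn ha hpos hδ hδa (fun η => ?_) ε hθ⟩
  rw [Set.mem_neg, capOne, Set.mem_ofPred_eq]
  refine and_congr (by simp) ?_
  by_cases hη : η ∈ Metric.sphere 0 1
  · have hη' : -η ∈ Metric.sphere (0 : EuclideanSpace ℝ (Fin n)) 1 := by simpa using hη
    rw [radialFunction_ellipsoid hpos hη, radialFunction_ellipsoid hpos hη', normRatio_neg]
    simp
  · have hr : radialFunction (ellipsoid a) (-η) = radialFunction (ellipsoid a) η := by
      simp [radialFunction, ellipsoid]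
    rw [hr]
    simp

theorem IsBumpedEllipsoid.mem_iff {s ε : ℝ} {K : Set (EuclideanSpace ℝ (Fin n))}
    (hK : IsBumpedEllipsoid hn a δ s ε K) {x : EuclideanSpace ℝ (Fin n)} (hx : x ≠ 0) :
    x ∈ K ↔ ‖x‖ ≤ normRatio a x + ε * capBump hn a δ s x := by
  obtain ⟨ρ, rfl, hρ⟩ := hK
  have hx' : 0 < ‖x‖⁻¹ := inv_pos.2 (norm_pos_iff.2 hx)
  rw [mem_bodyOfRadial_iff hx, hρ _ (by simp [norm_smul, hx]), normRatio_smul a hx',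
    capBump_smul hn a δ s hx']

include ha hpos hδ in
theorem half_lastIdx_le {s ε : ℝ} (hε : 0 < ε) (hε' : ε * δ ^ 3 ≤ a (lastIdx hn) / 2)
    {x : EuclideanSpace ℝ (Fin n)} (hx : x ≠ 0) :
    a (lastIdx hn) / 2 ≤ normRatio a x + ε * capBump hn a δ s x := by
  have h1 := lastIdx_le_normRatio hn ha hpos hx
  have h2 := mul_le_mul_of_nonneg_left (neg_le_of_abs_le (abs_capBump_le hn ha hpos hδ hx s)) hε.le
  linarith

include ha hpos hδ in
theorem IsBumpedEllipsoid.mem_of_norm_le {s ε : ℝ} {K : Set (EuclideanSpace ℝ (Fin n))}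
    (hK : IsBumpedEllipsoid hn a δ s ε K) (hε : 0 < ε) (hε' : ε * δ ^ 3 ≤ a (lastIdx hn) / 2)
    {x : EuclideanSpace ℝ (Fin n)} (hx : ‖x‖ ≤ a (lastIdx hn) / 2) : x ∈ K := by
  obtain ⟨ρ, rfl, hρ⟩ := hK
  have : Nonempty (Fin n) := ⟨firstIdx hn⟩
  refine mem_bodyOfRadial_of_norm_le (half_pos (hpos _)).le (fun θ hθ => ?_) hx
  rw [hρ θ hθ]
  exact half_lastIdx_le hn ha hpos hδ hε hε' (ne_zero_of_mem_unit_sphere ⟨θ, hθ⟩)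

include ha hpos hδ hδa in
/-- For small `ε`, the perturbed ellipsoid is a convex body. -/
theorem exists_forall_isConvexBody {s : ℝ} (hs : s ≠ 0) :
    ∃ ε₀ : ℝ, 0 < ε₀ ∧ ∀ ε, 0 < ε → ε < ε₀ → ∀ K, IsBumpedEllipsoid hn a δ s ε K →
      IsConvexBody K := by
  set α := a (firstIdx hn) with hα
  set β := a (lastIdx hn) with hβ
  have hα0 : 0 < α := hpos _
  have hβ0 : 0 < β := hpos _
  -- As `‖x‖ = √Q * u`, dividing the membership condition by `u` leaves `√Q ≤ 1 + ε ψ`, whose square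
  -- involves only `Q`, `ψ` and `ψ²`.
  set ψ : EuclideanSpace ℝ (Fin n) → ℝ := fun x => capBump hn a δ s x / normRatio a x with hψ
  have hu0 : ∀ x, x ≠ 0 → 0 < normRatio a x := fun x hx =>
    hβ0.trans_le (lastIdx_le_normRatio hn ha hpos hx)
  have hψC : ∀ x, x ≠ 0 → ContDiffAt ℝ 2 ψ x := fun x hx =>
    (contDiffAt_capBump hn ha hpos hδ hδa hs hx).div (contDiffAt_normRatio hpos hx) (hu0 x hx).ne'
  have hψC2 : ∀ x, x ≠ 0 → ContDiffAt ℝ 2 (fun y => ψ y ^ 2) x := fun x hx => (hψC x hx).pow 2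
  obtain ⟨C₁, hC₁, hb₁⟩ := secondDeriv_bounded hψC (half_pos hβ0) (α + β)
  obtain ⟨C₂, hC₂, hb₂⟩ := secondDeriv_bounded hψC2 (half_pos hβ0) (α + β)
  -- `α ^ 2` comes from `‖d‖² ≤ α² Q(d)`. The added `1` forces `ε ≤ 1`, so that `ε²` can be replaced
  -- by `ε`.
  set D := α ^ 2 * (2 * C₁ + C₂) + 1 with hD
  have hD1 : 1 ≤ D := by
    have : 0 ≤ α ^ 2 * (2 * C₁ + C₂) := by positivity
    linarith
  refine ⟨min (β / 2 / δ ^ 3) (1 / D), by positivity, fun ε hε hεlt K hK => ?_⟩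
  have hε1 : ε * δ ^ 3 ≤ β / 2 := by
    rw [← le_div_iff₀ (by positivity)]; exact (hεlt.trans_le (min_le_left _ _)).le
  have hεD : ε * D < 1 := by
    rw [← lt_div_iff₀ (by positivity)]; exact hεlt.trans_le (min_le_right _ _)
  have hball : ∀ x, ‖x‖ ≤ β / 2 → x ∈ K := fun x hx =>
    hK.mem_of_norm_le hn ha hpos hδ hε hε1 hx
  refine ⟨?_, ?_, ?_⟩
  · refine convex_of_secondDeriv_pos (M := α + β)
      (f := fun x => quadForm a x - 2 * ε * ψ x - ε ^ 2 * ψ x ^ 2 - 1)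
      (half_pos hβ0) hball ?_ ?_ ?_ ?_
    · intro x hx
      by_cases h0 : x = 0
      · rw [h0, norm_zero]; positivity
      · have h1 := (hK.mem_iff hn h0).1 hx
        have h2 := normRatio_le_firstIdx hn ha hpos h0
        have h3 := mul_le_mul_of_nonneg_left
          (le_of_abs_le (abs_capBump_le hn ha hpos hδ h0 s)) hε.le
        linarith
    · intro x hx
      have hu := hu0 x hx
      have hq := quadForm_pos hpos hx
      have hsq : √(quadForm a x) * normRatio a x = ‖x‖ := by
        rw [normRatio, mul_div_cancel₀ _ (Real.sqrt_pos.2 hq).ne']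
      have hfac : normRatio a x + ε * capBump hn a δ s x = (1 + ε * ψ x) * normRatio a x := by
        simp only [hψ]; field_simp
      have hpos' : 0 ≤ 1 + ε * ψ x := by
        have h := half_lastIdx_le hn ha hpos hδ (s := s) hε hε1 hx
        rw [hfac] at h
        exact (pos_of_mul_pos_left ((half_pos hβ0).trans_le h) hu.le).le
      rw [hK.mem_iff hn hx, hfac, ← hsq, mul_le_mul_iff_left₀ hu, Real.sqrt_le_left hpos']
      constructor <;> intro h <;> linarith
    · intro x hx
      have h1 := hψC x hx
      have h2 := hψC2 x hx
      have h3 := (contDiff_quadForm a).contDiffAt (x := x)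
      exact ((h3.sub (contDiffAt_const.mul h1)).sub (contDiffAt_const.mul h2)).sub contDiffAt_const
    · intro z hz1 hz2 d hd
      have hz : z ≠ 0 := norm_pos_iff.1 ((half_pos hβ0).trans_le hz1)
      have hd0 : 0 < ‖d‖ ^ 2 := by have := norm_pos_iff.2 hd; positivity
      rw [secondDeriv_sub_sub_mul (contDiff_quadForm a).contDiffAt (hψC z hz) (hψC2 z hz),
        secondDeriv_quadForm]
      have h1 := le_of_abs_le (hb₁ z hz1 hz2 d)
      have h2 := le_of_abs_le (hb₂ z hz1 hz2 d)
      have h3 : ‖d‖ ^ 2 ≤ α ^ 2 * quadForm a d := by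
        have := norm_sq_div_le_quadForm hpos (c := α) (x := d) fun i =>
          Or.inr (ha.antitone (Fin.le_def.2 (by simp [firstIdx])))
        rwa [div_le_iff₀' (by positivity)] at this
      have hε2 : ε ≤ 1 := by nlinarith
      have h4 : 2 * ε * secondDeriv ψ z d + ε ^ 2 * secondDeriv (fun y => ψ y ^ 2) z d
          ≤ ε * (2 * C₁ + C₂) * ‖d‖ ^ 2 := by
        have h5 : ε ^ 2 * (C₂ * ‖d‖ ^ 2) ≤ ε * (C₂ * ‖d‖ ^ 2) := by
          gcongr; nlinarith
        have h6 := mul_le_mul_of_nonneg_left h1 (by positivity : 0 ≤ 2 * ε)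
        have h7 := mul_le_mul_of_nonneg_left h2 (by positivity : 0 ≤ ε ^ 2)
        linarith
      have h5 : α ^ 2 * (ε * (2 * C₁ + C₂) * ‖d‖ ^ 2) < ‖d‖ ^ 2 := by
        have h8 : ε * (α ^ 2 * (2 * C₁ + C₂)) < 1 := by rw [hD] at hεD; linarith
        calc α ^ 2 * (ε * (2 * C₁ + C₂) * ‖d‖ ^ 2)
            = ε * (α ^ 2 * (2 * C₁ + C₂)) * ‖d‖ ^ 2 := by ring
          _ < 1 * ‖d‖ ^ 2 := by gcongr
          _ = ‖d‖ ^ 2 := one_mul _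
      have h6 : ε * (2 * C₁ + C₂) * ‖d‖ ^ 2 < quadForm a d :=
        lt_of_mul_lt_mul_left (h5.trans_le h3) (by positivity)
      linarith [quadForm_pos hpos hd]
  · obtain ⟨ρ, rfl, hρ⟩ := hK
    refine isCompact_bodyOfRadial ?_ fun θ hθ => ?_
    · refine ContinuousOn.congr (fun θ hθ => ?_) hρ
      have hθ0 : θ ≠ 0 := ne_zero_of_mem_unit_sphere ⟨θ, hθ⟩
      exact ((contDiffAt_normRatio hpos hθ0).continuousAt.add (continuousAt_const.mul
        (contDiffAt_capBump hn ha hpos hδ hδa hs hθ0).continuousAt)).continuousWithinAt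
    · rw [hρ θ hθ]
      exact (half_pos hβ0).trans_le
        (half_lastIdx_le hn ha hpos hδ hε hε1 (ne_zero_of_mem_unit_sphere ⟨θ, hθ⟩))
  · refine ⟨0, mem_interior.2 ⟨Metric.ball 0 (β / 2), fun x hx => hball x ?_,
      Metric.isOpen_ball, Metric.mem_ball_self (half_pos hβ0)⟩⟩
    simpa using (mem_ball_zero_iff.1 hx).le

end PerturbedBody

/-! ### Diagonal forms with one negative direction, and reflections along a basis. -/

section DiagonalForms

variable {ι W : Type*} [Fintype ι] [NormedAddCommGroup W] [InnerProductSpace ℝ W]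

/-- Two negative directions of a diagonal form span a plane, which meets every hyperplane. -/
theorem not_two_neg_of_nonneg_on_ker (b : OrthonormalBasis ι ℝ W) {ν : ι → ℝ} {ℓ : W →ₗ[ℝ] ℝ}
    (hℓ : ∀ z, ℓ z = 0 → 0 ≤ ∑ i, ν i * b.repr z i ^ 2) {i j : ι} (hij : i ≠ j)
    (hi : ν i < 0) : 0 ≤ ν j := by
  classical
  by_contra! hj
  have hQ : ∀ c d : ℝ, ∑ k, ν k * b.repr (c • b i + d • b j) k ^ 2 = ν i * c ^ 2 + ν j * d ^ 2 := by
    intro c d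
    rw [Fintype.sum_eq_add i j hij fun k hk => by simp [hk.1, hk.2]]
    simp [hij, hij.symm]
  by_cases h0 : ℓ (b i) = 0
  · have h1 := hℓ ((1 : ℝ) • b i + (0 : ℝ) • b j) (by simp [h0])
    rw [hQ] at h1
    linarith
  · have h1 := hℓ (ℓ (b j) • b i + (-ℓ (b i)) • b j) (by simp; ring)
    rw [hQ] at h1
    have h2 : 0 < ℓ (b i) ^ 2 := by positivity
    nlinarith [sq_nonneg (ℓ (b j))]

/-- A linear form whose kernel avoids the negative cone of a diagonal form has constant sign on
each nappe of that cone. -/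
theorem mul_pos_of_nonneg_on_ker (b : OrthonormalBasis ι ℝ W) {ν : ι → ℝ} {ℓ : W →ₗ[ℝ] ℝ}
    (hℓ : ∀ z, ℓ z = 0 → 0 ≤ ∑ i, ν i * b.repr z i ^ 2) {k : ι} (hν : ∀ i, i ≠ k → 0 ≤ ν i)
    {x y : W} (hk : b.repr y k = b.repr x k)
    (hxy : ∀ i, b.repr y i = b.repr x i ∨ b.repr y i = -b.repr x i)
    (hx : ∑ i, ν i * b.repr x i ^ 2 < 0) : 0 < ℓ x * ℓ y := by
  by_contra! hle
  -- If the signs disagreed, `ℓ` would vanish somewhere on the segment from `x` to `y`. That point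
  -- has the same `k`-th coordinate as `x` and no larger other coordinates in absolute value, so the
  -- form there is still negative.
  obtain ⟨t, ht0, ht1, ht⟩ : ∃ t : ℝ, 0 ≤ t ∧ t ≤ 1 ∧ (1 - t) * ℓ x + t * ℓ y = 0 := by
    have h0 : (0 : ℝ) ∈ segment ℝ (ℓ x) (ℓ y) := by
      rw [segment_eq_uIcc, Set.mem_uIcc]
      rcases le_total (ℓ x) 0 with h | h
      · by_cases hy : 0 ≤ ℓ y
        · exact Or.inl ⟨h, hy⟩
        · rcases h.eq_or_lt with h | h
          · exact Or.inr ⟨(not_le.1 hy).le, h.ge⟩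
          · nlinarith
      · by_cases hy : ℓ y ≤ 0
        · exact Or.inr ⟨hy, h⟩
        · rcases h.eq_or_lt with h | h
          · exact Or.inl ⟨h.ge, (not_le.1 hy).le⟩
          · nlinarith
    obtain ⟨p, t, hp, ht, hpt, h⟩ := h0
    refine ⟨t, ht, by linarith, ?_⟩
    rw [← hpt, add_sub_cancel_right]
    simpa using h
  have h1 := hℓ ((1 - t) • x + t • y) (by simpa using ht)
  refine absurd (h1.trans (Finset.sum_le_sum fun i _ => ?_)) (not_le.2 hx)
  have hz : b.repr ((1 - t) • x + t • y) i = (1 - t) * b.repr x i + t * b.repr y i := by simp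
  rw [hz]
  by_cases hik : i = k
  · subst hik
    rw [hk]
    apply le_of_eq; ring
  · refine mul_le_mul_of_nonneg_left ?_ (hν i hik)
    rcases hxy i with h | h <;> rw [h]
    · apply le_of_eq; ring
    · nlinarith [mul_nonneg (mul_nonneg ht0 (sub_nonneg.2 ht1)) (sq_nonneg (b.repr x i))]

/-- An involutive isometry is self-adjoint, so it can be moved onto the basis vector. -/
theorem repr_eq_of_involutive (b : OrthonormalBasis ι ℝ W) {φ : W ≃ₗᵢ[ℝ] W}
    (hφ : ∀ x, φ (φ x) = x) {σ : ι → ℝ} (hσ : ∀ i, φ (b i) = σ i • b i) (x : W) (i : ι) :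
    b.repr (φ x) i = σ i * b.repr x i := by
  rw [b.repr_apply_apply, b.repr_apply_apply, ← φ.inner_map_map, hφ, hσ, real_inner_smul_left]

theorem reflection_span_image_apply [DecidableEq ι] [FiniteDimensional ℝ W]
    (b : OrthonormalBasis ι ℝ W) (J : Finset ι) (i : ι) :
    (Submodule.span ℝ (b '' J)).reflection (b i) = (if i ∈ J then (1 : ℝ) else -1) • b i := by
  split_ifs with h
  · rw [one_smul]
    exact Submodule.reflection_mem_subspace_eq_self
      (Submodule.subset_span (Set.mem_image_of_mem _ h))
  · rw [neg_one_smul]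
    refine Submodule.reflection_mem_subspace_orthogonalComplement_eq_neg ?_
    rw [Submodule.mem_orthogonal']
    intro u hu
    induction hu using Submodule.span_induction with
    | mem x hx =>
      obtain ⟨j, hj, rfl⟩ := hx
      exact b.inner_eq_zero fun hij => h (hij ▸ hj)
    | zero => simp
    | add x y _ _ hx hy => rw [inner_add_right, hx, hy, add_zero]
    | smul c x _ hx => rw [inner_smul_right, hx, mul_zero]

theorem det_reflection_span_image [FiniteDimensional ℝ W] (b : OrthonormalBasis ι ℝ W)
    (J : Finset ι) (hJ : Even (Fintype.card ι - J.card)) :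
    LinearMap.det (Submodule.span ℝ (b '' J)).reflection.toLinearMap = 1 := by
  have h1 : Module.finrank ℝ (Submodule.span ℝ (b '' J)) = J.card := by
    have hli : LinearIndependent ℝ fun j : J => b j :=
      b.orthonormal.linearIndependent.comp _ Subtype.val_injective
    rw [Set.image_eq_range]
    exact (finrank_span_eq_card hli).trans (Fintype.card_coe J)
  have h2 := (Submodule.span ℝ (b '' J)).finrank_add_finrank_orthogonal
  rw [h1, Module.finrank_eq_card_basis b.toBasis] at h2
  rw [Submodule.det_reflection]
  exact Even.neg_one_pow (by rwa [← h2, Nat.add_sub_cancel_left] at hJ)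

end DiagonalForms

/-! ### Principal axes of a section, and signs on the two caps. -/

section Sections

variable {n : ℕ}

/-- On `W` the form is `‖A y‖²` with `A` the restriction of `diag(1 / a i)`, so the spectral theorem
for `A* A` applies. Decreasing eigenvalues mean increasing semi-axes: the first index is the
shortest axis, the last the longest. -/
theorem exists_diagonal_quadForm (a : Fin n → ℝ) (W : Submodule ℝ (EuclideanSpace ℝ (Fin n)))
    {m : ℕ} (hm : Module.finrank ℝ W = m) :
    ∃ (b : OrthonormalBasis (Fin m) ℝ W) (μ : Fin m → ℝ), Antitone μ ∧
      ∀ y : W, quadForm a y = ∑ i, μ i * b.repr y i ^ 2 := by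
  set A : W →ₗ[ℝ] EuclideanSpace ℝ (Fin n) :=
    (Matrix.toEuclideanLin (Matrix.diagonal fun i => (a i)⁻¹)).comp W.subtype with hA
  have hT := A.isSymmetric_adjoint_comp_self
  refine ⟨hT.eigenvectorBasis hm, hT.eigenvalues hm, hT.eigenvalues_antitone hm, fun y => ?_⟩
  have h1 : quadForm a y = inner ℝ y ((A.adjoint ∘ₗ A) y) := by
    rw [LinearMap.comp_apply, LinearMap.adjoint_inner_right, real_inner_self_eq_norm_sq,
      EuclideanSpace.real_norm_sq_eq, quadForm]
    refine Finset.sum_congr rfl fun i _ => ?_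
    simp [hA, Matrix.toLpLin_apply, Matrix.mulVec_diagonal]
    ring
  rw [h1, ← (hT.eigenvectorBasis hm).repr.inner_map_map, PiLp.inner_apply]
  refine Finset.sum_congr rfl fun i _ => ?_
  rw [hT.eigenvectorBasis_apply_self_apply]
  simp
  ring

theorem isPrincipalBasis_of_diagonal {a : Fin n → ℝ} (hpos : ∀ i, 0 < a i)
    {W : Submodule ℝ (EuclideanSpace ℝ (Fin n))} {m : ℕ} {b : OrthonormalBasis (Fin m) ℝ W}
    {μ : Fin m → ℝ} (hμ : ∀ y : W, quadForm a y = ∑ i, μ i * b.repr y i ^ 2) :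
    IsPrincipalBasis (sectionBy (ellipsoid a) W) b := by
  classical
  have hμ0 : ∀ i, 0 < μ i := by
    intro i
    have h1 : (b i : EuclideanSpace ℝ (Fin n)) ≠ 0 := by
      rw [Ne, Submodule.coe_eq_zero]; exact b.orthonormal.ne_zero i
    have h2 := quadForm_pos hpos h1
    rw [hμ, Fintype.sum_eq_single i fun k hk => by simp [hk]] at h2
    simpa using h2
  refine ⟨fun i => (√(μ i))⁻¹, fun i => inv_pos.2 (Real.sqrt_pos.2 (hμ0 i)), ?_⟩
  ext y
  have h1 : y ∈ sectionBy (ellipsoid a) W ↔ quadForm a y = 1 := Iff.rfl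
  rw [h1, hμ, Set.mem_ofPred_eq]
  refine Eq.congr (Finset.sum_congr rfl fun i _ => ?_) rfl
  rw [inv_pow, Real.sq_sqrt (hμ0 i).le, div_inv_eq_mul, mul_comm]

theorem sum_sub_mul_repr {W : Submodule ℝ (EuclideanSpace ℝ (Fin n))} {m : ℕ} {a : Fin n → ℝ}
    {b : OrthonormalBasis (Fin m) ℝ W} {μ : Fin m → ℝ}
    (hμ : ∀ y : W, quadForm a y = ∑ i, μ i * b.repr y i ^ 2) (c : ℝ) (y : W) :
    ∑ i, (μ i - c) * b.repr y i ^ 2 = quadForm a y - c * ‖(y : EuclideanSpace ℝ (Fin n))‖ ^ 2 := by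
  have h1 : ‖(y : EuclideanSpace ℝ (Fin n))‖ ^ 2 = ∑ i, b.repr y i ^ 2 := by
    rw [← EuclideanSpace.real_norm_sq_eq, b.repr.norm_map, Submodule.coe_norm]
  simp only [sub_mul, Finset.sum_sub_distrib, hμ, h1, Finset.mul_sum]

/-- The coordinate functionals, restricted to a subspace. -/
noncomputable def coordOn (W : Submodule ℝ (EuclideanSpace ℝ (Fin n))) (i : Fin n) : W →ₗ[ℝ] ℝ :=
  (EuclideanSpace.proj (𝕜 := ℝ) i).toLinearMap.comp W.subtype

variable (hn : 4 ≤ n) {a : Fin n → ℝ} (ha : StrictAnti a) (hpos : ∀ i, 0 < a i) {δ : ℝ}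
  (hδ : 0 < δ) (hδa : ∀ i j : Fin n, (i : ℕ) + 1 = (j : ℕ) → δ < (a i - a j) / 2)
  {W : Submodule ℝ (EuclideanSpace ℝ (Fin n))} {m : ℕ} {b : OrthonormalBasis (Fin m) ℝ W}
  {μ : Fin m → ℝ} (hanti : Antitone μ)
  (hμ : ∀ y : W, quadForm a y = ∑ i, μ i * b.repr y i ^ 2)

include ha hpos hδ hδa hanti hμ in
theorem mul_firstIdx_pos {k : Fin m} (hk : ∀ i, i ≤ k) {x y : W} (hx : x ≠ 0)
    (hxk : b.repr y k = b.repr x k)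
    (hxy : ∀ i, b.repr y i = b.repr x i ∨ b.repr y i = -b.repr x i)
    (hu : a (firstIdx hn) - δ < normRatio a x) :
    0 < (x : EuclideanSpace ℝ (Fin n)) (firstIdx hn) *
      (y : EuclideanSpace ℝ (Fin n)) (firstIdx hn) := by
  have hα : 0 < a (firstIdx hn) - δ :=
    (hpos _).trans (lt_firstIdx_sub hn ha hδ hδa (firstIdx_ne_lastIdx hn).symm)
  set c : ℝ := ((a (firstIdx hn) - δ) ^ 2)⁻¹ with hc
  have hℓ : ∀ z : W, coordOn W (firstIdx hn) z = 0 → 0 ≤ ∑ i, (μ i - c) * b.repr z i ^ 2 := by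
    intro z hz
    rw [sum_sub_mul_repr hμ, sub_nonneg]
    by_cases h0 : z = 0
    · simp [h0, quadForm]
    · have h0' : (z : EuclideanSpace ℝ (Fin n)) ≠ 0 := by rwa [Ne, Submodule.coe_eq_zero]
      have := (normRatio_lt_iff hpos hα h0').1
        (normRatio_lt_of_firstIdx_eq_zero hn ha hpos hδ hδa h0' hz)
      rw [hc, inv_mul_eq_div]
      exact this.le
  refine mul_pos_of_nonneg_on_ker b hℓ (k := k) (fun i hi => ?_) hxk hxy ?_
  · by_contra! h
    have h1 := not_two_neg_of_nonneg_on_ker b hℓ hi h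
    linarith [hanti (hk i)]
  · have hx' : (x : EuclideanSpace ℝ (Fin n)) ≠ 0 := by rwa [Ne, Submodule.coe_eq_zero]
    rw [sum_sub_mul_repr hμ, sub_neg, hc, inv_mul_eq_div]
    exact (lt_normRatio_iff hpos hα hx').1 hu

include ha hpos hδ hδa hanti hμ in
-- The same nappe argument with the form reversed to `c - μ`, whose only possible negative direction
-- is the shortest axis.
theorem mul_lastIdx_pos {k : Fin m} (hk : ∀ i, k ≤ i) {x y : W} (hx : x ≠ 0)
    (hxk : b.repr y k = b.repr x k)
    (hxy : ∀ i, b.repr y i = b.repr x i ∨ b.repr y i = -b.repr x i)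
    (hu : normRatio a x < a (lastIdx hn) + δ) :
    0 < (x : EuclideanSpace ℝ (Fin n)) (lastIdx hn) *
      (y : EuclideanSpace ℝ (Fin n)) (lastIdx hn) := by
  have hβ : 0 < a (lastIdx hn) + δ := add_pos (hpos _) hδ
  set c : ℝ := ((a (lastIdx hn) + δ) ^ 2)⁻¹ with hc
  have hneg : ∀ z : W, ∑ i, (c - μ i) * b.repr z i ^ 2
      = -(quadForm a z - c * ‖(z : EuclideanSpace ℝ (Fin n))‖ ^ 2) := fun z => by
    rw [← sum_sub_mul_repr hμ, ← Finset.sum_neg_distrib]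
    exact Finset.sum_congr rfl fun i _ => by ring
  have hℓ : ∀ z : W, coordOn W (lastIdx hn) z = 0 → 0 ≤ ∑ i, (c - μ i) * b.repr z i ^ 2 := by
    intro z hz
    rw [hneg, neg_sub, sub_nonneg]
    by_cases h0 : z = 0
    · simp [h0, quadForm]
    · have h0' : (z : EuclideanSpace ℝ (Fin n)) ≠ 0 := by rwa [Ne, Submodule.coe_eq_zero]
      have := (lt_normRatio_iff hpos hβ h0').1
        (lt_normRatio_of_lastIdx_eq_zero hn ha hpos hδ hδa h0' hz)
      rw [hc, inv_mul_eq_div]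
      exact this.le
  refine mul_pos_of_nonneg_on_ker b hℓ (k := k) (fun i hi => ?_) hxk hxy ?_
  · by_contra! h
    have h1 := not_two_neg_of_nonneg_on_ker b hℓ hi h
    linarith [hanti (hk i)]
  · have hx' : (x : EuclideanSpace ℝ (Fin n)) ≠ 0 := by rwa [Ne, Submodule.coe_eq_zero]
    rw [hneg, neg_sub, sub_neg, hc, inv_mul_eq_div]
    exact (normRatio_lt_iff hpos hβ hx').1 hu

include ha hpos hδ hδa hanti hμ in
/-- An isometry that flips the longest axis of the section, keeps its shortest axis, and flips or
keeps each of the others, exchanges the sections of the two perturbed ellipsoids. -/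
theorem image_section_eq {k₁ k₂ : Fin m} (hk₁ : ∀ i, i ≤ k₁) (hk₂ : ∀ i, k₂ ≤ i)
    {φ : W ≃ₗᵢ[ℝ] W} (hφ : ∀ x, φ (φ x) = x) {σ : Fin m → ℝ} (hφσ : ∀ i, φ (b i) = σ i • b i)
    (hσ : ∀ i, σ i = 1 ∨ σ i = -1) (hσ₁ : σ k₁ = -1) (hσ₂ : σ k₂ = 1) {ε : ℝ}
    {K L : Set (EuclideanSpace ℝ (Fin n))} (hK : IsBumpedEllipsoid hn a δ 1 ε K)
    (hL : IsBumpedEllipsoid hn a δ (-1) ε L) (hK0 : 0 ∈ K) (hL0 : 0 ∈ L) :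
    φ '' sectionBy K W = sectionBy L W := by
  have hmem : ∀ x : W, (x : EuclideanSpace ℝ (Fin n)) ∈ K ↔
      (φ x : EuclideanSpace ℝ (Fin n)) ∈ L := by
    intro x
    by_cases hx : x = 0
    · simp [hx, hK0, hL0]
    have hx' : (x : EuclideanSpace ℝ (Fin n)) ≠ 0 := by rwa [Ne, Submodule.coe_eq_zero]
    have hφx' : (φ x : EuclideanSpace ℝ (Fin n)) ≠ 0 := by simpa using hx
    have hrepr := repr_eq_of_involutive b hφ hφσ x
    have hnorm : ‖(φ x : EuclideanSpace ℝ (Fin n))‖ = ‖(x : EuclideanSpace ℝ (Fin n))‖ :=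
      φ.norm_map x
    have hquad : quadForm a (φ x) = quadForm a x := by
      rw [hμ, hμ]
      refine Finset.sum_congr rfl fun i _ => ?_
      rw [hrepr]
      rcases hσ i with h | h <;> rw [h] <;> ring
    have hratio : normRatio a (φ x) = normRatio a x := by rw [normRatio, normRatio, hnorm, hquad]
    have hbump : capBump hn a δ (-1) (φ x) = capBump hn a δ 1 x := by
      rw [capBump, capBump, hratio]
      congr 1
      · by_cases hu : a (firstIdx hn) - δ < normRatio a x
        -- It is `-φ x` that shares the longest-axis coordinate of `x`, hence its nappe; so `φ`
        -- itself reverses the sign of the first coordinate.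
        · have h1 := mul_firstIdx_pos hn ha hpos hδ hδa hanti hμ hk₁ (x := x) (y := -φ x) hx
            (by simp [hrepr, hσ₁])
            (fun i => by rcases hσ i with h | h <;> simp [hrepr, h]) hu
          have h2 : 0 < -1 * (φ x : EuclideanSpace ℝ (Fin n)) (firstIdx hn) ↔
              0 < 1 * (x : EuclideanSpace ℝ (Fin n)) (firstIdx hn) := by
            rw [Submodule.coe_neg, PiLp.neg_apply] at h1
            rw [neg_one_mul, one_mul]
            exact (pos_iff_pos_of_mul_pos h1).symm
          simp only [h2]
        · simp [max_eq_right (sub_nonpos.2 (not_lt.1 hu))]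
      · by_cases hu : normRatio a x < a (lastIdx hn) + δ
        · have h1 := mul_lastIdx_pos hn ha hpos hδ hδa hanti hμ hk₂ (x := x) (y := φ x) hx
            (by simp [hrepr, hσ₂])
            (fun i => by rcases hσ i with h | h <;> simp [hrepr, h]) hu
          simp only [← pos_iff_pos_of_mul_pos h1]
        · simp [max_eq_right (sub_nonpos.2 (not_lt.1 hu))]
    rw [hK.mem_iff hn hx', hL.mem_iff hn hφx', hbump, hratio, hnorm]
  ext y
  constructor
  · rintro ⟨x, hx, rfl⟩
    exact (hmem x).1 hx
  · intro hy
    exact ⟨φ y, (hmem _).2 (by rwa [hφ]), hφ y⟩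

end Sections

/-! ### Points on the extreme axes that tell `K` from `L` and from `-L`. -/

section NotCongruent

variable {n : ℕ} (hn : 4 ≤ n) {a : Fin n → ℝ} (ha : StrictAnti a) (hpos : ∀ i, 0 < a i) {δ : ℝ}
  (hδ : 0 < δ) (hδa : ∀ i j : Fin n, (i : ℕ) + 1 = (j : ℕ) → δ < (a i - a j) / 2)

theorem normRatio_single (hpos : ∀ i, 0 < a i) (i : Fin n) {t : ℝ} (ht : t ≠ 0) :
    normRatio a (EuclideanSpace.single i t) = a i := by
  have hq : quadForm a (EuclideanSpace.single i t) = (t / a i) ^ 2 := by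
    rw [quadForm, Fintype.sum_eq_single i fun k hk => by simp [hk]]
    simp [div_pow]
  rw [normRatio, hq, Real.sqrt_sq_eq_abs, abs_div, abs_of_pos (hpos i), PiLp.norm_single,
    Real.norm_eq_abs]
  have := abs_pos.2 ht
  have := hpos i
  field_simp

include hpos hδ in
theorem capBump_single_firstIdx {s t : ℝ} (ht : t ≠ 0) :
    capBump hn a δ s (EuclideanSpace.single (firstIdx hn) t)
      = if 0 < s * t then δ ^ 3 else 0 := by
  rw [capBump, normRatio_single hpos _ ht]
  simp [(firstIdx_ne_lastIdx hn).symm, hδ.le]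

include hpos hδ in
theorem capBump_single_lastIdx {s t : ℝ} (ht : t ≠ 0) :
    capBump hn a δ s (EuclideanSpace.single (lastIdx hn) t)
      = if 0 < t then -δ ^ 3 else 0 := by
  rw [capBump, normRatio_single hpos _ ht]
  simp only [PiLp.single_apply, (firstIdx_ne_lastIdx hn), if_false, mul_zero, lt_irrefl,
    if_true, add_sub_cancel_left, max_eq_left hδ.le]
  split_ifs <;> simp

include hpos hδ in
theorem IsBumpedEllipsoid.ne {ε : ℝ} (hε : 0 < ε) {K L : Set (EuclideanSpace ℝ (Fin n))}
    (hK : IsBumpedEllipsoid hn a δ 1 ε K) (hL : IsBumpedEllipsoid hn a δ (-1) ε L) : K ≠ L := by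
  have hεδ : 0 < ε * δ ^ 3 := by positivity
  have hα := hpos (firstIdx hn)
  -- The tip of the bump of `K` on the positive longest axis, where `L` has radius only `a₁`.
  set t := a (firstIdx hn) + ε * δ ^ 3 with ht
  have ht0 : 0 < t := by positivity
  set x : EuclideanSpace ℝ (Fin n) := EuclideanSpace.single (firstIdx hn) t with hx
  have hx0 : x ≠ 0 := by simpa [hx] using ht0.ne'
  have hnorm : ‖x‖ = t := by rw [hx, PiLp.norm_single, Real.norm_of_nonneg ht0.le]
  intro hKL
  have h1 : x ∈ K := by
    rw [hK.mem_iff hn hx0, hnorm, hx, normRatio_single hpos _ ht0.ne',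
      capBump_single_firstIdx hn hpos hδ ht0.ne', if_pos (by simpa using ht0)]
  rw [hKL, hL.mem_iff hn hx0, hnorm, hx, normRatio_single hpos _ ht0.ne',
    capBump_single_firstIdx hn hpos hδ ht0.ne', if_neg (by linarith)] at h1
  linarith

include hpos hδ in
theorem IsBumpedEllipsoid.ne_neg {ε : ℝ} (hε : 0 < ε) {K L : Set (EuclideanSpace ℝ (Fin n))}
    (hK : IsBumpedEllipsoid hn a δ 1 ε K) (hL : IsBumpedEllipsoid hn a δ (-1) ε L) : K ≠ -L := by
  have hεδ : 0 < ε * δ ^ 3 := by positivity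
  -- `L` keeps the radius `aₙ` along `-eₙ`, whereas `K` is dented along `eₙ`.
  set t := a (lastIdx hn) with ht
  have ht0 : 0 < t := hpos _
  set x : EuclideanSpace ℝ (Fin n) := EuclideanSpace.single (lastIdx hn) (-t) with hx
  have hx0 : x ≠ 0 := by simpa [hx] using ht0.ne'
  have hnx : -x = EuclideanSpace.single (lastIdx hn) t := by
    ext i; by_cases hi : i = lastIdx hn <;> simp [hx, hi]
  have hnorm : ‖x‖ = t := by rw [hx, PiLp.norm_single, norm_neg, Real.norm_of_nonneg ht0.le]
  intro hKL
  have h1 : -x ∈ K := by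
    rw [hKL, Set.mem_neg, neg_neg, hL.mem_iff hn hx0, hnorm, hx,
      normRatio_single hpos _ (neg_ne_zero.2 ht0.ne'),
      capBump_single_lastIdx hn hpos hδ (neg_ne_zero.2 ht0.ne'), if_neg (by linarith)]
    linarith
  rw [hK.mem_iff hn (neg_ne_zero.2 hx0), norm_neg, hnorm, hnx, normRatio_single hpos _ ht0.ne',
    capBump_single_lastIdx hn hpos hδ ht0.ne', if_pos ht0] at h1
  linarith

end NotCongruent

/-! ### Assembly: choice of the kept axes by the parity of `n`. -/

theorem theorem1p5 (n : ℕ) (hn : 4 ≤ n) (a : Fin n → ℝ) (ha : StrictAnti a)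
    (hpos : ∀ i, 0 < a i) (δ : ℝ) (hδ : 0 < δ)
    (hδa : ∀ i j : Fin n, (i : ℕ) + 1 = (j : ℕ) → δ < (a i - a j) / 2) :
    ∃ ε₀ : ℝ, 0 < ε₀ ∧ ∀ ε : ℝ, 0 < ε → ε < ε₀ →
      IsConvexBody (bodyK hn a δ ε) ∧ IsConvexBody (bodyL hn a δ ε) ∧
      bodyK hn a δ ε ≠ bodyL hn a δ ε ∧ bodyK hn a δ ε ≠ -bodyL hn a δ ε ∧
      ∀ ξ : EuclideanSpace ℝ (Fin n), ‖ξ‖ = 1 →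
        ∃ φ : ↥(ℝ ∙ ξ)ᗮ ≃ₗᵢ[ℝ] ↥(ℝ ∙ ξ)ᗮ,
          LinearMap.det (φ.toLinearEquiv : ↥(ℝ ∙ ξ)ᗮ →ₗ[ℝ] ↥(ℝ ∙ ξ)ᗮ) = 1 ∧
          φ '' sectionBy (bodyK hn a δ ε) (ℝ ∙ ξ)ᗮ = sectionBy (bodyL hn a δ ε) (ℝ ∙ ξ)ᗮ ∧
          ∃ b : OrthonormalBasis (Fin (n - 1)) ℝ ↥(ℝ ∙ ξ)ᗮ,
            IsPrincipalBasis (sectionBy (ellipsoid a) (ℝ ∙ ξ)ᗮ) b ∧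
            (Even n → ∃ i, φ = (ℝ ∙ b i).reflection) ∧
            (Odd n → ∃ i j, i ≠ j ∧ φ = (Submodule.span ℝ {b i, b j}).reflection) := by
  obtain ⟨ε₁, hε₁, h₁⟩ := exists_forall_isConvexBody hn ha hpos hδ hδa (one_ne_zero (α := ℝ))
  obtain ⟨ε₂, hε₂, h₂⟩ := exists_forall_isConvexBody hn ha hpos hδ hδa (s := -1) (by norm_num)
  have hβ := hpos (lastIdx hn)
  refine ⟨min (min ε₁ ε₂) (a (lastIdx hn) / 2 / δ ^ 3), by positivity, fun ε hε hlt => ?_⟩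
  have hlt₁ : ε < ε₁ := hlt.trans_le ((min_le_left _ _).trans (min_le_left _ _))
  have hlt₂ : ε < ε₂ := hlt.trans_le ((min_le_left _ _).trans (min_le_right _ _))
  have hεδ : ε * δ ^ 3 ≤ a (lastIdx hn) / 2 := by
    rw [← le_div_iff₀ (by positivity)]; exact (hlt.trans_le (min_le_right _ _)).le
  have hK := isBumpedEllipsoid_bodyK hn ha hpos hδ hδa ε
  have hL := isBumpedEllipsoid_bodyL hn ha hpos hδ hδa ε
  refine ⟨h₁ ε hε hlt₁ _ hK, h₂ ε hε hlt₂ _ hL, hK.ne hn hpos hδ hε hL,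
    hK.ne_neg hn hpos hδ hε hL, fun ξ hξ => ?_⟩
  have hξ0 : ξ ≠ 0 := by rintro rfl; simp at hξ
  have hfr : Module.finrank ℝ (ℝ ∙ ξ)ᗮ = n - 1 := by
    have : Fact (Module.finrank ℝ (EuclideanSpace ℝ (Fin n)) = n - 1 + 1) :=
      ⟨by rw [finrank_euclideanSpace_fin]; omega⟩
    exact Submodule.finrank_orthogonal_span_singleton hξ0
  obtain ⟨b, μ, hanti, hμ⟩ := exists_diagonal_quadForm a (ℝ ∙ ξ)ᗮ hfr
  have h0 : ‖(0 : EuclideanSpace ℝ (Fin n))‖ ≤ a (lastIdx hn) / 2 := by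
    rw [norm_zero]; positivity
  -- `J` indexes the kept axes: it must contain the shortest (index `0`), omit the longest (index `n
  -- - 2`, the last in `Fin (n - 1)`), and leave an even number to flip.
  have hrot : ∀ J : Finset (Fin (n - 1)), Even (n - 1 - J.card) → ⟨0, by omega⟩ ∈ J →
      ⟨n - 2, by omega⟩ ∉ J →
      LinearMap.det (Submodule.span ℝ (b '' J)).reflection.toLinearMap = 1 ∧
      (Submodule.span ℝ (b '' J)).reflection '' sectionBy (bodyK hn a δ ε) (ℝ ∙ ξ)ᗮ
        = sectionBy (bodyL hn a δ ε) (ℝ ∙ ξ)ᗮ := by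
    intro J hJ hJ₂ hJ₁
    refine ⟨det_reflection_span_image b J (by rwa [Fintype.card_fin]), ?_⟩
    refine image_section_eq hn ha hpos hδ hδa hanti hμ (k₁ := ⟨n - 2, by omega⟩)
      (k₂ := ⟨0, by omega⟩) (fun i => Fin.le_def.2 (by have := i.2; simp only; omega))
      (fun i => Fin.le_def.2 (Nat.zero_le _)) (Submodule.reflection_reflection _)
      (reflection_span_image_apply b J) (fun i => ?_) (if_neg hJ₁) (if_pos hJ₂) hK hL
      (hK.mem_of_norm_le hn ha hpos hδ hε hεδ h0) (hL.mem_of_norm_le hn ha hpos hδ hε hεδ h0)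
    split_ifs <;> simp
  have hb := isPrincipalBasis_of_diagonal hpos hμ
  rcases Nat.even_or_odd n with he | ho
  · have hlast : (⟨n - 2, by omega⟩ : Fin (n - 1)) ∉
        ({⟨0, by omega⟩} : Finset (Fin (n - 1))) := by
      simp only [Finset.mem_singleton, Fin.mk.injEq]
      omega
    obtain ⟨h1, h2⟩ := hrot {⟨0, by omega⟩}
      (by obtain ⟨r, hr⟩ := he; exact ⟨r - 1, by rw [Finset.card_singleton]; omega⟩)
      (by simp) hlast
    refine ⟨_, h1, h2, b, hb, fun _ => ⟨⟨0, by omega⟩, ?_⟩,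
      fun ho => absurd he (Nat.not_even_iff_odd.2 ho)⟩
    simp only [Finset.coe_singleton, Set.image_singleton]
  -- For odd `n` at least `5` the last index `n - 2` is at least `3`, so keeping axes `0` and `1`
  -- still flips the longest one.
  · have hne : (⟨0, by omega⟩ : Fin (n - 1)) ≠ ⟨1, by omega⟩ := by simp
    have hlast : (⟨n - 2, by omega⟩ : Fin (n - 1)) ∉
        ({⟨0, by omega⟩, ⟨1, by omega⟩} : Finset (Fin (n - 1))) := by
      obtain ⟨r, hr⟩ := ho
      simp only [Finset.mem_insert, Finset.mem_singleton, Fin.mk.injEq]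
      omega
    obtain ⟨h1, h2⟩ := hrot {⟨0, by omega⟩, ⟨1, by omega⟩}
      (by obtain ⟨r, hr⟩ := ho; exact ⟨r - 1, by rw [Finset.card_pair hne]; omega⟩)
      (by simp) hlast
    refine ⟨_, h1, h2, b, hb, fun he => absurd he (Nat.not_even_iff_odd.2 ho),
      fun _ => ⟨_, _, hne, ?_⟩⟩
    simp only [Finset.coe_pair, Set.image_pair]
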